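/- Let $R$ be an associative ring with identity. We say that $R$ has finite (right) uniform dimension if, for some $n\ge 0$, there are uniform right ideals $I_1,\dots,I_n$ of $R$ whose sum is direct and is an essential right ideal of $R$ (a right ideal is uniform if it is nonzero and any two nonzero right ideals contained in it have nonzero intersection). A (unital) twisted partial action of $\mathbb{Z}$ on $R$ is a triple $\alpha=(\{D_i\}_{i\in\mathbb{Z}},\{\alpha_i\}_{i\in\mathbb{Z}},\{w_{i,j}\}_{i,j\in\mathbb{Z}})$, where each $D_i$ is a two-sided ideal of $R$ generated by a central idempotent $1_i$, each $\alpha_i:D_{-i}\to D_i$ is a ring isomorphism, and each $w_{i,j}$ is an invertible element of the ring $D_iD_{i+j}$ (with identity $1_i1_{i+j}$), such that for all $i,j,k\in\mathbb{Z}$: (i) $D_0=R$ and $\alpha_0=\mathrm{id}_R$; (ii) $\alpha_i(D_{-i}D_j)=D_iD_{i+j}$; (iii) $\alpha_i(\alpha_j(a))=w_{i,j}\,\alpha_{i+j}(a)\,w_{i,j}^{-1}$ for all $a\in D_{-j}D_{-j-i}$; (iv) $w_{i,0}=w_{0,i}=1_i$; (v) $\alpha_i(a\,w_{j,k})\,w_{i,j+k}=\alpha_i(a)\,w_{i,j}\,w_{i+j,k}$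 for all $a\in D_{-i}D_jD_{j+k}$. It is of finite type if there are $s_1,\dots,s_n\in\mathbb{Z}$ such that $\sum_{l=1}^n D_{j+s_l}=R$ for every $j\in\mathbb{Z}$. A twisted global action of $\mathbb{Z}$ on an associative, not necessarily unital ring $T$ consists of ring automorphisms $\beta_i$ of $T$ and invertible multipliers $u_{i,j}$ of $T$ ($i,j\in\mathbb{Z}$) such that, for all $i,j,k\in\mathbb{Z}$ and $t\in T$: $\beta_0=\mathrm{id}_T$; $\beta_i(\beta_j(t))=u_{i,j}\,\beta_{i+j}(t)\,u_{i,j}^{-1}$; $u_{i,0}=u_{0,i}=1$; and $\beta_i(t\,u_{j,k})\,u_{i,j+k}=\beta_i(t)\,u_{i,j}\,u_{i+j,k}$. (A multiplier $m$ of $T$ is a pair of additive maps $t\mapsto mt$, $t\mapsto tm$ of $T$ with $m(ab)=(ma)b$, $(ab)m=a(bm)$ and $(am)b=a(mb)$; multipliers compose by $(mn)t=m(nt)$, $t(mn)=(tm)n$.) It is an enveloping action (globalization) of $\alpha$ if there is an injective ring homomorphism $\varphi:R\to T$ such that, for all $i,j\in\mathbb{Z}$: $\varphi(R)$ is a two-sided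 ideal of $T$; $T=\sum_{i\in\mathbb{Z}}\beta_i(\varphi(R))$; $\varphi(D_i)=\varphi(R)\cap\beta_i(\varphi(R))$; $\varphi(\alpha_i(a))=\beta_i(\varphi(a))$ for all $a\in D_{-i}$; and $\varphi(a\,w_{i,j})=\varphi(a)\,u_{i,j}$, $\varphi(w_{i,j}\,a)=u_{i,j}\,\varphi(a)$ for all $a\in D_iD_{i+j}$. Theorem. Let $R$ be a ring with identity of finite uniform dimension and let $\alpha$ be a twisted partial action of $\mathbb{Z}$ on $R$. If $\alpha$ is of finite type, then $\alpha$ has an enveloping action. -/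

import Mathlib

universe u

/-! ### Right uniform (Goldie) dimension -/

/-- A module is uniform if it is nonzero and any two nonzero submodules meet nontrivially;
here for a submodule `U` of `M`. -/
def IsUniformSubmodule {A M : Type*} [Ring A] [AddCommGroup M] [Module A M]
    (U : Submodule A M) : Prop :=
  U ≠ ⊥ ∧ ∀ V W : Submodule A M, V ≤ U → W ≤ U → V ≠ ⊥ → W ≠ ⊥ → V ⊓ W ≠ ⊥

/-- A submodule is essential if it meets every nonzero submodule nontrivially. -/
def IsEssentialSubmodule {A M : Type*} [Ring A] [AddCommGroup M] [Module A M]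
    (N : Submodule A M) : Prop :=
  ∀ V : Submodule A M, V ≠ ⊥ → N ⊓ V ≠ ⊥

/-- `R` has right uniform dimension `n`: some direct sum of `n` uniform right ideals is an
essential right ideal. Right ideals are the `Rᵐᵒᵖ`-submodules of `R`. -/
def HasRightUniformDim (R : Type u) [Ring R] (n : ℕ) : Prop :=
  ∃ I : Fin n → Submodule Rᵐᵒᵖ R,
    (∀ k, IsUniformSubmodule (I k)) ∧ iSupIndep I ∧ IsEssentialSubmodule (⨆ k, I k)

/-- `R` has finite right uniform dimension. -/
def HasFiniteUniformDim (R : Type u) [Ring R] : Prop :=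
  ∃ n : ℕ, HasRightUniformDim R n

/-! ### Unital twisted partial actions of `ℤ` -/

/-- The product of two two-sided ideals: the ideal generated by the products `a * b`. -/
def idealProd {R : Type u} [Ring R] (I J : TwoSidedIdeal R) : TwoSidedIdeal R :=
  TwoSidedIdeal.span {x : R | ∃ a ∈ I, ∃ b ∈ J, x = a * b}

/-- A unital twisted partial action of the additive group `ℤ` on a unital ring `R`.
The element `e i` is the central idempotent written `1_i`; it is the identity of `D i`.
The element `winv i j` is the (unique) inverse of `w i j` in the ring `D i * D (i + j)`, whose
identity is `e i * e (i + j)`. -/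
structure TwistedPartialAction (R : Type u) [Ring R] where
  D : ℤ → TwoSidedIdeal R
  e : ℤ → R
  α : ∀ i : ℤ, D (-i) ≃+* D i
  w : ℤ → ℤ → R
  winv : ℤ → ℤ → R
  e_idem : ∀ i, e i * e i = e i
  e_central : ∀ i, ∀ r : R, e i * r = r * e i
  D_eq : ∀ i, D i = TwoSidedIdeal.span {e i}
  w_mem : ∀ i j, w i j ∈ idealProd (D i) (D (i + j))
  winv_mem : ∀ i j, winv i j ∈ idealProd (D i) (D (i + j))
  w_mul_winv : ∀ i j, w i j * winv i j = e i * e (i + j)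
  winv_mul_w : ∀ i j, winv i j * w i j = e i * e (i + j)
  D_zero : D 0 = ⊤
  α_zero : ∀ a : D (-0), (α 0 a : R) = a
  /-- `α_i (D_{-i} D_j) = D_i D_{i+j}`. -/
  α_image : ∀ i j,
    (fun a : D (-i) => (α i a : R)) '' {a | (a : R) ∈ idealProd (D (-i)) (D j)} =
      (idealProd (D i) (D (i + j)) : Set R)
  /-- `α_i (α_j a) = w_{i,j} α_{i+j}(a) w_{i,j}⁻¹` for `a ∈ D_{-j} D_{-j-i}`.
  The membership proofs `hj`, `hij`, `hi` only make the three values of `α` typecheck: they all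
  follow from the first hypothesis on `a` (`hi` with the help of `α_image`). -/
  α_comp : ∀ i j, ∀ a : R, a ∈ idealProd (D (-j)) (D (-j - i)) →
    ∀ (hj : a ∈ D (-j)) (hij : a ∈ D (-(i + j))) (hi : (α j ⟨a, hj⟩ : R) ∈ D (-i)),
      (α i ⟨(α j ⟨a, hj⟩ : R), hi⟩ : R) = w i j * (α (i + j) ⟨a, hij⟩ : R) * winv i j
  w_zero_right : ∀ i, w i 0 = e i
  w_zero_left : ∀ i, w 0 i = e i
  /-- `α_i (a w_{j,k}) w_{i,j+k} = α_i(a) w_{i,j} w_{i+j,k}` for `a ∈ D_{-i} D_j D_{j+k}`. -/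
  cocycle : ∀ i j k, ∀ a : R, a ∈ idealProd (idealProd (D (-i)) (D j)) (D (j + k)) →
    ∀ ha : a ∈ D (-i),
      (α i ⟨a * w j k, (D (-i)).mul_mem_right a (w j k) ha⟩ : R) * w i (j + k) =
        (α i ⟨a, ha⟩ : R) * w i j * w (i + j) k

/-- Finite type: for some finite set `s` of integers, `∑_{k ∈ s} D_{j+k} = R` for every `j`.
(The supremum of two-sided ideals is their sum.) -/
def TwistedPartialAction.IsOfFiniteType {R : Type u} [Ring R]
    (α : TwistedPartialAction R) : Prop :=
  ∃ s : Finset ℤ, ∀ j : ℤ, (⨆ k ∈ s, α.D (j + k)) = ⊤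

/-! ### Multipliers of a not necessarily unital ring -/

/-- A multiplier `m` of a ring `T`: `lmul t` is `m t`, and `rmul t` is `t m`. -/
@[ext]
structure RingMultiplier (T : Type u) [NonUnitalRing T] where
  lmul : T →+ T
  rmul : T →+ T
  lmul_mul : ∀ a b : T, lmul (a * b) = lmul a * b
  mul_rmul : ∀ a b : T, rmul (a * b) = a * rmul b
  rmul_mul : ∀ a b : T, rmul a * b = a * lmul b

namespace RingMultiplier

variable {T : Type u} [NonUnitalRing T]

/-- `(m n) t = m (n t)`, `t (m n) = (t m) n`. -/
instance : Mul (RingMultiplier T) where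
  mul m n :=
    { lmul := m.lmul.comp n.lmul
      rmul := n.rmul.comp m.rmul
      lmul_mul := fun a b => by simp [m.lmul_mul, n.lmul_mul]
      mul_rmul := fun a b => by simp [m.mul_rmul, n.mul_rmul]
      rmul_mul := fun a b => by simp [m.rmul_mul, n.rmul_mul] }

instance : One (RingMultiplier T) where
  one :=
    { lmul := AddMonoidHom.id T
      rmul := AddMonoidHom.id T
      lmul_mul := fun _ _ => rfl
      mul_rmul := fun _ _ => rfl
      rmul_mul := fun _ _ => rfl }

instance : Monoid (RingMultiplier T) where
  mul_assoc _ _ _ := rfl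
  one_mul _ := rfl
  mul_one _ := rfl

end RingMultiplier

/-! ### Twisted global actions and enveloping actions -/

/-- A twisted global action of `ℤ` on a not necessarily unital ring `T`; the twisting is by
invertible multipliers of `T`. -/
structure TwistedGlobalAction (T : Type u) [NonUnitalRing T] where
  β : ℤ → T ≃+* T
  u : ℤ → ℤ → (RingMultiplier T)ˣ
  β_zero : ∀ t, β 0 t = t
  /-- `β_i (β_j t) = u_{i,j} β_{i+j}(t) u_{i,j}⁻¹`. -/
  β_comp : ∀ i j, ∀ t : T,
    β i (β j t) = (↑(u i j)⁻¹ : RingMultiplier T).rmul ((u i j).val.lmul (β (i + j) t))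
  u_zero_right : ∀ i, u i 0 = 1
  u_zero_left : ∀ i, u 0 i = 1
  /-- `β_i (t u_{j,k}) u_{i,j+k} = β_i(t) u_{i,j} u_{i+j,k}`. -/
  cocycle : ∀ i j k, ∀ t : T,
    (u i (j + k)).val.rmul (β i ((u j k).val.rmul t)) =
      (u (i + j) k).val.rmul ((u i j).val.rmul (β i t))

/-- The twisted global action `β` on `T` is an enveloping action of `α`, via `φ : R → T`. -/
structure IsEnvelopingVia {R : Type u} [Ring R] (α : TwistedPartialAction R)
    {T : Type u} [NonUnitalRing T] (β : TwistedGlobalAction T) (φ : R →ₙ+* T) : Prop where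
  injective : Function.Injective φ
  /-- `φ(R)` is an ideal of `T`. -/
  mul_mem_left : ∀ (t : T) (r : R), t * φ r ∈ Set.range φ
  mul_mem_right : ∀ (t : T) (r : R), φ r * t ∈ Set.range φ
  /-- `T = ∑_i β_i(φ(R))`. -/
  sum_eq_top : AddSubgroup.closure (⋃ i : ℤ, β.β i '' Set.range φ) = ⊤
  /-- `φ(D_i) = φ(R) ∩ β_i(φ(R))`. -/
  map_D : ∀ i, φ '' (α.D i : Set R) = Set.range φ ∩ β.β i '' Set.range φ
  map_α : ∀ i, ∀ a : α.D (-i), φ (α.α i a : R) = β.β i (φ a)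
  /-- `φ(a w_{i,j}) = φ(a) u_{i,j}` and `φ(w_{i,j} a) = u_{i,j} φ(a)` for `a ∈ D_i D_{i+j}`. -/
  map_mul_w : ∀ i j, ∀ a ∈ idealProd (α.D i) (α.D (i + j)),
    φ (a * α.w i j) = (β.u i j).val.rmul (φ a)
  map_w_mul : ∀ i j, ∀ a ∈ idealProd (α.D i) (α.D (i + j)),
    φ (α.w i j * a) = (β.u i j).val.lmul (φ a)

/-- `α` has an enveloping action (a globalization). -/
def TwistedPartialAction.HasEnvelopingAction {R : Type u} [Ring R]
    (α : TwistedPartialAction R) : Prop :=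
  ∃ (T : Type u) (_ : NonUnitalRing T) (β : TwistedGlobalAction T) (φ : R →ₙ+* T),
    IsEnvelopingVia α β φ

/-!
Let `1_i` be the identity of `D_i`. Since the `D_{g + s}`, for `s` in a fixed finite set, sum to
`R`, making the idempotents `1_g, 1_{g + s_1}, 1_{g + s_2}, …` disjoint decomposes `1` into
orthogonal central idempotents, compatibly with `α` as `g` varies. Reindex the twist as
`w_{a,b-a}`, so that the cocycle identity becomes invariant under translation. Cut `R` by the
products of a piece of the decomposition for `a` with a piece of the decomposition for `b`, and
glue the corresponding values of the twist: this extends `w_{a,b-a}` from `D_a D_b` to a unit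
`U a b` of `R`, and the cocycle identity survives because it can be checked piece by piece.

Once the twist consists of units, the untwisted construction applies: `R` embeds into the functions
`ℤ → R` by `a ↦ (n ↦ α_n(1_{-n} a))`, the group `ℤ` acts on these functions by translation twisted
by `U`, and the sum of the translates of the image of `R` is an enveloping action.
-/

/-! ### Central idempotents -/

section Center

variable {R : Type u} [Ring R]

theorem center_coe_eq_smul_one (z : Subring.center R) : (z : R) = z • (1 : R) := (mul_one _).symm

theorem mem_span_singleton_center_iff {z : Subring.center R} {x : R} :
    x ∈ TwoSidedIdeal.span {(z : R)} ↔ ∃ r, z • r = x := by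
  refine ⟨fun hx => ?_, ?_⟩
  · induction hx using TwoSidedIdeal.span_induction with
    | mem x hx => exact ⟨1, by simp_all [Subring.smul_def]⟩
    | zero => exact ⟨0, smul_zero z⟩
    | add x y _ _ hx hy =>
      obtain ⟨⟨r, rfl⟩, ⟨s, rfl⟩⟩ := And.intro hx hy
      exact ⟨r + s, smul_add z r s⟩
    | neg x _ hx =>
      obtain ⟨r, rfl⟩ := hx
      exact ⟨-r, smul_neg z r⟩
    | left_absorb a x _ hx =>
      obtain ⟨r, rfl⟩ := hx
      exact ⟨a * r, (mul_smul_comm z a r).symm⟩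
    | right_absorb b x _ hx =>
      obtain ⟨r, rfl⟩ := hx
      exact ⟨r * b, (smul_mul_assoc z r b).symm⟩
  · rintro ⟨r, rfl⟩
    exact TwoSidedIdeal.mul_mem_right _ _ _ (TwoSidedIdeal.subset_span rfl)

theorem mem_span_singleton_center_iff_smul_eq {z : Subring.center R} (hz : IsIdempotentElem z)
    {x : R} : x ∈ TwoSidedIdeal.span {(z : R)} ↔ z • x = x := by
  rw [mem_span_singleton_center_iff]
  refine ⟨?_, fun h => ⟨x, h⟩⟩
  rintro ⟨r, rfl⟩
  rw [smul_smul, hz.eq]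

theorem idealProd_span_singleton_center (y z : Subring.center R) :
    idealProd (TwoSidedIdeal.span {(y : R)}) (TwoSidedIdeal.span {(z : R)}) =
      TwoSidedIdeal.span {((y * z : Subring.center R) : R)} := by
  refine le_antisymm (TwoSidedIdeal.span_le.2 ?_) (TwoSidedIdeal.span_le.2 ?_)
  · rintro _ ⟨a, ha, b, hb, rfl⟩
    obtain ⟨r, rfl⟩ := mem_span_singleton_center_iff.1 ha
    obtain ⟨s, rfl⟩ := mem_span_singleton_center_iff.1 hb
    exact mem_span_singleton_center_iff.2 ⟨r * s, (smul_mul_smul_comm y r z s).symm⟩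
  · rintro _ rfl
    exact TwoSidedIdeal.subset_span
      ⟨y, TwoSidedIdeal.subset_span rfl, z, TwoSidedIdeal.subset_span rfl, rfl⟩

end Center

section Glue

theorem smul_eq_smul_of_dvd {Z M : Type*} [CommMonoid Z] [MulAction Z M] {y z : Z} (h : y ∣ z)
    {a b : M} (hab : y • a = y • b) : z • a = z • b := by
  obtain ⟨c, rfl⟩ := h
  rw [mul_comm, mul_smul, hab, ← mul_smul]

theorem smul_mul_congr {Z R : Type*} [CommSemiring Z] [Semiring R] [Algebra Z R] {z : Z}
    {x x' y y' : R} (hx : z • x = z • x') (hy : z • y = z • y') :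
    z • (x * y) = z • (x' * y') := by
  rw [← smul_mul_assoc, hx, smul_mul_assoc, ← mul_smul_comm, hy, mul_smul_comm]

theorem completeOrthogonalIdempotents_prod {Z ι κ : Type*} [CommSemiring Z] [Fintype ι] [Fintype κ]
    {p : ι → Z} {q : κ → Z} (hp : CompleteOrthogonalIdempotents p)
    (hq : CompleteOrthogonalIdempotents q) :
    CompleteOrthogonalIdempotents fun i : ι × κ => p i.1 * q i.2 where
  idem i := (hp.idem i.1).mul (hq.idem i.2)
  ortho i j hij := by
    change p i.1 * q i.2 * (p j.1 * q j.2) = 0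
    rw [mul_mul_mul_comm]
    by_cases h : i.1 = j.1
    · rw [hq.ortho fun h' => hij (Prod.ext h h'), mul_zero]
    · rw [hp.ortho h, zero_mul]
  complete := by
    rw [Fintype.sum_prod_type, ← Fintype.sum_mul_sum, hp.complete, hq.complete, one_mul]

theorem completeOrthogonalIdempotents_disjointed {Z ι : Type*} [CommRing Z] [Fintype ι]
    [LinearOrder ι] {f : ι → Z} (hf : ∀ i, IsIdempotentElem (f i)) (h : ∏ i, (1 - f i) = 0) :
    CompleteOrthogonalIdempotents fun i => f i * ∏ j with j < i, (1 - f j) where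
  idem i := (hf i).mul (by
    rw [IsIdempotentElem, ← Finset.prod_mul_distrib]
    exact Finset.prod_congr rfl fun j _ => (hf j).one_sub.eq)
  ortho := by
    have orth_of_lt : ∀ {i k : ι}, i < k →
        f i * (∏ j with j < i, (1 - f j)) * (f k * ∏ j with j < k, (1 - f j)) = 0 := by
      intro i k hik
      have hfi : f i * ∏ j with j < k, (1 - f j) = 0 := by
        rw [← Finset.mul_prod_erase _ _ (Finset.mem_filter.2 ⟨Finset.mem_univ i, hik⟩), ← mul_assoc,
          (hf i).mul_one_sub_self, zero_mul]
      grind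
    intro i k hik
    rcases lt_or_gt_of_ne hik with hlt | hlt
    · exact orth_of_lt hlt
    · exact (mul_comm _ _).trans (orth_of_lt hlt)
  complete := by rw [← sub_sub_cancel 1 (∑ i, _), ← Finset.prod_one_sub_ordered, h, sub_zero]

variable {Z ι : Type*} [CommSemiring Z] [Fintype ι] {p : ι → Z}

theorem eq_of_forall_smul_eq {M : Type*} [AddCommMonoid M] [Module Z M] (hp : ∑ i, p i = 1)
    {x y : M} (h : ∀ i, p i • x = p i • y) : x = y := by
  rw [← one_smul Z x, ← one_smul Z y, ← hp, Finset.sum_smul, Finset.sum_smul]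
  exact Finset.sum_congr rfl fun i _ => h i

theorem smul_sum_smul {M : Type*} [AddCommMonoid M] [Module Z M] (hp : OrthogonalIdempotents p)
    (x : ι → M) (i : ι) :
    p i • ∑ j, p j • x j = p i • x i := by
  classical
  simp_rw [Finset.smul_sum, smul_smul, hp.mul_eq, ite_smul, zero_smul]
  simp

theorem exists_unit_forall_smul_eq {R : Type*} [Semiring R] [Algebra Z R]
    (hp : CompleteOrthogonalIdempotents p) {x y : ι → R}
    (hxy : ∀ i, p i • (x i * y i) = p i • 1) (hyx : ∀ i, p i • (y i * x i) = p i • 1) :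
    ∃ u : Rˣ, ∀ i, p i • (u : R) = p i • x i :=
  ⟨{ val := ∑ i, p i • x i
     inv := ∑ i, p i • y i
     val_inv := eq_of_forall_smul_eq hp.complete fun i => (smul_mul_congr
      (smul_sum_smul hp.1 x i) (smul_sum_smul hp.1 y i)).trans (hxy i)
     inv_val := eq_of_forall_smul_eq hp.complete fun i => (smul_mul_congr
      (smul_sum_smul hp.1 y i) (smul_sum_smul hp.1 x i)).trans (hyx i) },
    smul_sum_smul hp.1 x⟩

end Glue

/-! ### Twisted actions by units and their restrictions -/

section Idealizer

variable {B : Type*} [Ring B]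

/-- The elements of `B` which multiply the additive subgroup `S` into itself from both sides. -/
def idealizer (S : AddSubgroup B) : Submonoid B where
  carrier := {m | ∀ s ∈ S, m * s ∈ S ∧ s * m ∈ S}
  one_mem' s hs := ⟨by rwa [one_mul], by rwa [mul_one]⟩
  mul_mem' hm hn s hs :=
    ⟨by simpa only [mul_assoc] using (hm _ (hn s hs).1).1,
      by simpa only [mul_assoc] using (hn _ (hm s hs).2).2⟩

theorem mem_idealizer_iSup {ι : Sort*} {S : ι → AddSubgroup B} {m : B}
    (hm : ∀ i, m ∈ idealizer (S i)) : m ∈ idealizer (⨆ i, S i) := fun s hs => by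
  induction hs using AddSubgroup.iSup_induction' with
  | hp i s hs => exact ⟨le_iSup S i (hm i s hs).1, le_iSup S i (hm i s hs).2⟩
  | h1 => simp [zero_mem]
  | hadd s t _ _ hs ht =>
    exact ⟨by simpa only [mul_add] using add_mem hs.1 ht.1,
      by simpa only [add_mul] using add_mem hs.2 ht.2⟩

theorem mem_idealizer_map {C : Type*} [Ring C] {S : AddSubgroup B} {f : B ≃+* C} {m : C}
    (hm : f.symm m ∈ idealizer S) : m ∈ idealizer (S.map (f : B →+ C)) := by
  rintro _ ⟨s, hs, rfl⟩
  exact ⟨⟨_, (hm s hs).1, by simp⟩, ⟨_, (hm s hs).2, by simp⟩⟩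

theorem conj_mem_of_mem_idealizer_units {S : AddSubgroup B} {v : Bˣ} (hv : v ∈ (idealizer S).units)
    {s : B} (hs : s ∈ S) : v * s * ↑v⁻¹ ∈ S :=
  (hv.2 _ (hv.1 s hs).1).2

end Idealizer

namespace RingMultiplier

variable {B : Type u} [Ring B] (T : NonUnitalSubring B)

/-- The elements of `B` idealizing the subring `T` act on `T` as multipliers. -/
def ofIdealizer : idealizer T.toAddSubgroup →* RingMultiplier T where
  toFun m :=
    { lmul := ((AddMonoidHom.mulLeft (m : B)).comp (AddSubmonoidClass.subtype T)).codRestrict T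
        fun t => (m.2 t t.2).1
      rmul := ((AddMonoidHom.mulRight (m : B)).comp (AddSubmonoidClass.subtype T)).codRestrict T
        fun t => (m.2 t t.2).2
      lmul_mul a b := Subtype.ext (mul_assoc (m : B) a b).symm
      mul_rmul a b := Subtype.ext (mul_assoc (a : B) b m)
      rmul_mul a b := Subtype.ext (mul_assoc (a : B) m b) }
  map_one' := RingMultiplier.ext (AddMonoidHom.ext fun t => Subtype.ext (one_mul (t : B)))
    (AddMonoidHom.ext fun t => Subtype.ext (mul_one (t : B)))
  map_mul' m n := RingMultiplier.ext
    (AddMonoidHom.ext fun t => Subtype.ext (mul_assoc (m : B) n t))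
    (AddMonoidHom.ext fun t => Subtype.ext (mul_assoc (t : B) m n).symm)

/-- The units of `B` idealizing the subring `T`, as invertible multipliers of `T`. -/
def ofUnits : (idealizer T.toAddSubgroup).units →* (RingMultiplier T)ˣ :=
  (Units.map (ofIdealizer T)).comp (Submonoid.unitsEquivUnitsType _).toMonoidHom

end RingMultiplier

/-- A twisted action of `G` on the unital ring `B`, whose twist consists of units of `B`. -/
structure UnitTwistedAction (G B : Type*) [AddGroup G] [Ring B] where
  β : G → B ≃+* B
  u : G → G → Bˣ
  β_zero (b : B) : β 0 b = b
  β_comp (g h : G) (b : B) : β g (β h b) = u g h * β (g + h) b * ↑(u g h)⁻¹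
  u_zero_right (g : G) : u g 0 = 1
  u_zero_left (g : G) : u 0 g = 1
  cocycle (g h k : G) : β g (u h k) * u g (h + k) = (u g h * u (g + h) k : B)

namespace UnitTwistedAction

section OfTransition

variable {G A : Type*} [AddGroup G] [Ring A]

/-- The translation action of `G` on functions `G → A`, twisted by the units `U n (n + g)`. Its
twist is the coboundary of these units. -/
def ofTransition (U : G → G → Aˣ) (hU : ∀ n, U n n = 1) : UnitTwistedAction G (G → A) where
  β g :=
    { toFun f n := U n (n + g) * f (n + g) * ↑(U n (n + g))⁻¹
      invFun f n := ↑(U (n - g) n)⁻¹ * f (n - g) * U (n - g) n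
      left_inv f := funext fun n => by simp [mul_assoc]
      right_inv f := funext fun n => by simp [mul_assoc]
      map_mul' f f' := funext fun n => by simp [mul_assoc]
      map_add' f f' := funext fun n => by simp [mul_add, add_mul] }
  u g h := MulEquiv.piUnits.symm fun n =>
    U n (n + g) * U (n + g) (n + g + h) * (U n (n + (g + h)))⁻¹
  β_zero f := funext fun n => by simp [hU]
  β_comp g h f := funext fun n => by simp [mul_assoc, add_assoc]
  u_zero_right g := Units.ext (funext fun n => by simp [hU])
  u_zero_left g := Units.ext (funext fun n => by simp [hU])
  cocycle g h k := funext fun n => by simp [mul_assoc, add_assoc]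

end OfTransition

variable {G B : Type*} [AddGroup G] [Ring B] (Θ : UnitTwistedAction G B)

theorem β_symm_apply (g : G) (b : B) :
    (Θ.β g).symm b = ↑(Θ.u (-g) g)⁻¹ * Θ.β (-g) b * Θ.u (-g) g := by
  have h := Θ.β_comp (-g) g ((Θ.β g).symm b)
  rw [neg_add_cancel, β_zero, RingEquiv.apply_symm_apply] at h
  rw [h]
  simp [mul_assoc]

theorem β_symm_β (k l : G) (b : B) :
    (Θ.β k).symm (Θ.β l b) = ((Θ.u (-k) k)⁻¹ * Θ.u (-k) l : Bˣ) * Θ.β (-k + l) b *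
      ↑((Θ.u (-k) k)⁻¹ * Θ.u (-k) l)⁻¹ := by
  rw [β_symm_apply, β_comp]
  simp [mul_assoc]

theorem map_β_symm_u_mem {N : Subgroup Bˣ} (hN : ∀ g h, Θ.u g h ∈ N) (k g h : G) :
    Units.map (Θ.β k).symm.toMonoidHom (Θ.u g h) ∈ N := by
  have : Units.map (Θ.β k).symm.toMonoidHom (Θ.u g h) = (Θ.u (-k) k)⁻¹ *
      (Θ.u (-k) g * Θ.u (-k + g) h * (Θ.u (-k) (g + h))⁻¹) * Θ.u (-k) k := by
    refine Units.ext ((Θ.β_symm_apply k _).trans ?_)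
    rw [Units.val_mul, Units.val_mul, Units.val_mul, Units.val_mul, ← cocycle,
      Units.mul_inv_cancel_right]
  rw [this]
  exact mul_mem (mul_mem (inv_mem (hN _ _)) (mul_mem (mul_mem (hN _ _) (hN _ _))
    (inv_mem (hN _ _)))) (hN _ _)

/-- The condition for the additive subgroup `S` to be an ideal in the sum of its translates, and
for this sum to be a twisted global action. -/
structure IsLocalIdeal (S : AddSubgroup B) : Prop where
  u_mem (g h : G) : Θ.u g h ∈ (idealizer S).units
  mul_mem_left (g : G) {s t : B} (hs : s ∈ S) (ht : t ∈ S) : Θ.β g t * s ∈ S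
  mul_mem_right (g : G) {s t : B} (hs : s ∈ S) (ht : t ∈ S) : s * Θ.β g t ∈ S

/-- The sum of the translates of `S`. -/
def translatesSum (S : AddSubgroup B) : AddSubgroup B := ⨆ g, S.map (Θ.β g : B →+ B)

theorem β_mem_translatesSum {S : AddSubgroup B} (g : G) {s : B} (hs : s ∈ S) :
    Θ.β g s ∈ Θ.translatesSum S :=
  le_iSup (fun g => S.map (Θ.β g : B →+ B)) g ⟨s, hs, rfl⟩

theorem le_translatesSum (S : AddSubgroup B) : S ≤ Θ.translatesSum S := fun s hs => by
  simpa only [β_zero] using Θ.β_mem_translatesSum 0 hs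

theorem map_mem_of_mem_translatesSum {C : Type*} [AddGroup C] {S : AddSubgroup B}
    {S' : AddSubgroup C} (F : B →+ C) (hF : ∀ g, ∀ s ∈ S, F (Θ.β g s) ∈ S') {t : B}
    (ht : t ∈ Θ.translatesSum S) : F t ∈ S' :=
  iSup_le (a := S'.comap F) (fun g => AddSubgroup.map_le_iff_le_comap.2 (hF g)) ht

namespace IsLocalIdeal

variable {Θ} {S : AddSubgroup B} (hS : Θ.IsLocalIdeal S)

include hS

theorem u_mem_idealizer_units (g h : G) : Θ.u g h ∈ (idealizer (Θ.translatesSum S)).units := by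
  have u_mem (k : G) := Θ.map_β_symm_u_mem hS.u_mem k g h
  exact ⟨mem_idealizer_iSup fun k => mem_idealizer_map (u_mem k).1,
    mem_idealizer_iSup fun k => mem_idealizer_map (u_mem k).2⟩

theorem β_mem (g : G) {t : B} (ht : t ∈ Θ.translatesSum S) : Θ.β g t ∈ Θ.translatesSum S := by
  refine Θ.map_mem_of_mem_translatesSum (Θ.β g : B →+ B) (fun k s hs => ?_) ht
  change Θ.β g (Θ.β k s) ∈ Θ.translatesSum S
  rw [β_comp]
  exact conj_mem_of_mem_idealizer_units (hS.u_mem_idealizer_units g k)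
    (Θ.β_mem_translatesSum _ hs)

theorem β_symm_mem (g : G) {t : B} (ht : t ∈ Θ.translatesSum S) :
    (Θ.β g).symm t ∈ Θ.translatesSum S := by
  refine Θ.map_mem_of_mem_translatesSum ((Θ.β g).symm : B →+ B) (fun k s hs => ?_) ht
  change (Θ.β g).symm (Θ.β k s) ∈ Θ.translatesSum S
  rw [β_symm_β]
  exact conj_mem_of_mem_idealizer_units
    (mul_mem (inv_mem (hS.u_mem_idealizer_units _ _)) (hS.u_mem_idealizer_units _ _))
    (Θ.β_mem_translatesSum _ hs)

theorem mul_mem_of_mem_left {s t : B} (hs : s ∈ S) (ht : t ∈ Θ.translatesSum S) : s * t ∈ S :=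
  Θ.map_mem_of_mem_translatesSum (AddMonoidHom.mulLeft s) (fun g _ => hS.mul_mem_right g hs) ht

theorem mul_mem_of_mem_right {s t : B} (ht : t ∈ Θ.translatesSum S) (hs : s ∈ S) : t * s ∈ S :=
  Θ.map_mem_of_mem_translatesSum (AddMonoidHom.mulRight s) (fun g _ => hS.mul_mem_left g hs) ht

theorem mul_mem_translatesSum {t t' : B} (ht : t ∈ Θ.translatesSum S)
    (ht' : t' ∈ Θ.translatesSum S) : t * t' ∈ Θ.translatesSum S := by
  refine Θ.map_mem_of_mem_translatesSum (AddMonoidHom.mulRight t') (fun k s hs => ?_) ht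
  change Θ.β k s * t' ∈ Θ.translatesSum S
  rw [← (Θ.β k).apply_symm_apply t', ← map_mul]
  exact Θ.β_mem_translatesSum k (hS.mul_mem_of_mem_left hs (hS.β_symm_mem k ht'))

/-- The sum of the translates of a local ideal, as a ring: the carrier of the enveloping action. -/
def envelope : NonUnitalSubring B :=
  { Θ.translatesSum S with mul_mem' := hS.mul_mem_translatesSum }

end IsLocalIdeal

/-- The restriction of a twisted action of `ℤ` to the envelope of a local ideal. -/
def IsLocalIdeal.globalAction {B : Type u} [Ring B] {Θ : UnitTwistedAction ℤ B}
    {S : AddSubgroup B} (hS : Θ.IsLocalIdeal S) : TwistedGlobalAction hS.envelope where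
  β g :=
    { toFun t := ⟨Θ.β g t, hS.β_mem g t.2⟩
      invFun t := ⟨(Θ.β g).symm t, hS.β_symm_mem g t.2⟩
      left_inv t := Subtype.ext ((Θ.β g).symm_apply_apply t)
      right_inv t := Subtype.ext ((Θ.β g).apply_symm_apply t)
      map_mul' t t' := Subtype.ext (map_mul (Θ.β g) (t : B) t')
      map_add' t t' := Subtype.ext (map_add (Θ.β g) (t : B) t') }
  u g h := RingMultiplier.ofUnits hS.envelope ⟨Θ.u g h, hS.u_mem_idealizer_units g h⟩
  β_zero t := Subtype.ext (Θ.β_zero t)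
  β_comp g h t := Subtype.ext (Θ.β_comp g h t)
  u_zero_right g :=
    (congrArg _ (Subtype.ext (Θ.u_zero_right g))).trans (map_one (RingMultiplier.ofUnits _))
  u_zero_left g :=
    (congrArg _ (Subtype.ext (Θ.u_zero_left g))).trans (map_one (RingMultiplier.ofUnits _))
  cocycle g h k t := Subtype.ext (by
    change Θ.β g (t * Θ.u h k) * Θ.u g (h + k) = Θ.β g t * Θ.u g h * Θ.u (g + h) k
    rw [map_mul, mul_assoc, cocycle, mul_assoc])

theorem IsLocalIdeal.closure_iUnion_image_eq_top {B : Type u} [Ring B] {Θ : UnitTwistedAction ℤ B}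
    {S : AddSubgroup B} (hS : Θ.IsLocalIdeal S) :
    AddSubgroup.closure (⋃ g, hS.globalAction.β g '' {t | (t : B) ∈ S}) = ⊤ := by
  refine eq_top_iff.2 fun t _ => ?_
  obtain ⟨t', ht', h⟩ := Θ.map_mem_of_mem_translatesSum (AddMonoidHom.id B)
    (S' := (AddSubgroup.closure (⋃ g, hS.globalAction.β g '' {t | (t : B) ∈ S})).map
      (AddSubmonoidClass.subtype hS.envelope))
    (fun g s hs => ⟨_, AddSubgroup.subset_closure (Set.mem_iUnion.2
      ⟨g, ⟨s, Θ.le_translatesSum S hs⟩, hs, rfl⟩), rfl⟩) t.2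
  exact Subtype.ext h ▸ ht'

end UnitTwistedAction

/-! ### The partial action on the whole ring -/

namespace TwistedPartialAction

variable {R : Type u} [Ring R] (α : TwistedPartialAction R)

/-- The idempotent `1_i`, as an element of the center of `R`. The center acts on `R` by
multiplication, so that `α.idem i • x` is the product `1_i x`. -/
def idem (i : ℤ) : Subring.center R :=
  ⟨α.e i, Subring.mem_center_iff.2 fun r => (α.e_central i r).symm⟩

theorem isIdempotentElem_idem (i : ℤ) : IsIdempotentElem (α.idem i) :=
  Subtype.ext (α.e_idem i)

theorem mem_D {i : ℤ} {x : R} : x ∈ α.D i ↔ α.idem i • x = x := by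
  rw [D_eq]
  exact mem_span_singleton_center_iff_smul_eq (α.isIdempotentElem_idem i)

theorem idealProd_D (i j : ℤ) :
    idealProd (α.D i) (α.D j) = TwoSidedIdeal.span {((α.idem i * α.idem j :) : R)} := by
  rw [D_eq, D_eq]
  exact idealProd_span_singleton_center (α.idem i) (α.idem j)

theorem mem_idealProd_D {i j : ℤ} {x : R} :
    x ∈ idealProd (α.D i) (α.D j) ↔ (α.idem i * α.idem j) • x = x := by
  rw [idealProd_D, mem_span_singleton_center_iff_smul_eq
    ((α.isIdempotentElem_idem i).mul (α.isIdempotentElem_idem j))]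

theorem mem_idealProd_idealProd_D {i j k : ℤ} {x : R} :
    x ∈ idealProd (idealProd (α.D i) (α.D j)) (α.D k) ↔
      (α.idem i * α.idem j * α.idem k) • x = x := by
  rw [idealProd_D, D_eq α k, show α.e k = α.idem k from rfl, idealProd_span_singleton_center,
    mem_span_singleton_center_iff_smul_eq (((α.isIdempotentElem_idem i).mul
      (α.isIdempotentElem_idem j)).mul (α.isIdempotentElem_idem k))]

theorem idem_smul_idem_smul (i : ℤ) (x : R) : α.idem i • α.idem i • x = α.idem i • x := by
  rw [smul_smul, (α.isIdempotentElem_idem i).eq]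

theorem idem_zero : α.idem 0 = 1 := by
  have one_mem : (1 : R) ∈ α.D 0 := by simp [α.D_zero]
  exact Subtype.ext ((mul_one _).symm.trans (α.mem_D.1 one_mem))

theorem mul_idem_smul_self (i j : ℤ) (x : R) :
    (α.idem i * α.idem j) • (α.idem i * α.idem j) • x = (α.idem i * α.idem j) • x := by
  rw [smul_smul, ((α.isIdempotentElem_idem i).mul (α.isIdempotentElem_idem j)).eq]

/-- The projection `a ↦ 1_i a` of `R` onto its direct factor `D_i`. -/
def proj (i : ℤ) : R →ₙ+* α.D i where
  toFun a := ⟨α.idem i • a, α.mem_D.2 (α.idem_smul_idem_smul i a)⟩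
  map_mul' a b := Subtype.ext (by
    change _ = α.idem i • a * α.idem i • b
    rw [smul_mul_smul_comm, (α.isIdempotentElem_idem i).eq])
  map_zero' := Subtype.ext (smul_zero _)
  map_add' a b := Subtype.ext (smul_add _ a b)

/-- The isomorphism `α_i : D_{-i} → D_i` extended to `R`, that is `a ↦ α_i(1_{-i} a)`. -/
def act (i : ℤ) : R →ₙ+* R where
  toFun a := α.α i (α.proj (-i) a)
  map_mul' a b := by rw [map_mul, map_mul]; rfl
  map_zero' := by rw [map_zero, map_zero]; rfl
  map_add' a b := by rw [map_add, map_add]; rfl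

theorem act_of_mem {i : ℤ} {a : R} (ha : a ∈ α.D (-i)) : (α.α i ⟨a, ha⟩ : R) = α.act i a := by
  congr 2
  exact Subtype.ext (α.mem_D.1 ha).symm

theorem act_mem (i : ℤ) (a : R) : α.act i a ∈ α.D i := Subtype.property _

theorem idem_smul_act (i : ℤ) (a : R) : α.idem i • α.act i a = α.act i a :=
  α.mem_D.1 (α.act_mem i a)

theorem act_idem_neg_smul (i : ℤ) (a : R) : α.act i (α.idem (-i) • a) = α.act i a :=
  (α.act_of_mem (α.mem_D.2 (α.idem_smul_idem_smul _ a))).symm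

theorem act_zero_apply (a : R) : α.act 0 a = a := by
  have ha : a ∈ α.D (-0) := by simp [α.D_zero]
  rw [← α.act_of_mem ha, α.α_zero]

theorem act_mem_idealProd (i : ℤ) {j : ℤ} {x : R} (hx : x ∈ α.D j) :
    α.act i x ∈ idealProd (α.D i) (α.D (i + j)) := by
  refine (α.α_image i j).subset ⟨α.proj (-i) x, α.mem_idealProd_D.2 ?_, rfl⟩
  change _ • α.idem (-i) • x = α.idem (-i) • x
  rw [← α.mem_D.1 hx, smul_smul (α.idem (-i)), mul_idem_smul_self]

theorem act_idem (i j : ℤ) : α.act i (α.idem j) = (α.idem i * α.idem (i + j) :) := by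
  obtain ⟨b, b_mem, act_b⟩ : ((α.idem i * α.idem (i + j) :) : R) ∈ _ '' _ :=
    (α.α_image i j).superset (α.mem_idealProd_D.2
      (((α.isIdempotentElem_idem i).mul (α.isIdempotentElem_idem (i + j))).map
        (Subring.center R).subtype))
  replace act_b : α.act i b = (α.idem i * α.idem (i + j) :) := (α.act_of_mem b.2).symm.trans act_b
  have idem_smul_b : α.idem j • (b : R) = b := by
    rw [← α.mem_idealProd_D.1 b_mem, smul_smul, mul_left_comm, (α.isIdempotentElem_idem j).eq]
  calc α.act i (α.idem j)
      = (α.idem i * α.idem (i + j)) • α.act i (α.idem j) :=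
        (α.mem_idealProd_D.1 (α.act_mem_idealProd i (α.mem_D.2 (α.e_idem j)))).symm
    _ = α.act i (b * α.idem j) := by rw [map_mul, act_b]; rfl
    _ = α.act i (α.idem j • (b : R)) :=
        congrArg (α.act i) (Subring.mem_center_iff.1 (α.idem j).2 b)
    _ = (α.idem i * α.idem (i + j) :) := by rw [idem_smul_b, act_b]

theorem act_one (i : ℤ) : α.act i 1 = α.idem i • 1 := by
  have h := α.act_idem i 0
  rwa [idem_zero, add_zero, (α.isIdempotentElem_idem i).eq,
    center_coe_eq_smul_one (α.idem i)] at h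

theorem act_smul_of_act_eq {m : ℤ} {y z : Subring.center R}
    (h : α.act m y = (α.idem m * z :)) (x : R) : α.act m (y • x) = z • α.act m x := by
  rw [Subring.smul_def, smul_eq_mul, map_mul, h, mul_comm, Subring.coe_mul, mul_assoc]
  exact congrArg (z • ·) (α.idem_smul_act m x)

theorem act_idem_smul (i j : ℤ) (x : R) :
    α.act i (α.idem j • x) = α.idem (i + j) • α.act i x :=
  α.act_smul_of_act_eq (α.act_idem i j) x

/-- The twist `w_{a,b-a}`, an invertible element of `D_a D_b`. In this indexing the cocycle
identity is invariant under translation of all the indices. -/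
def transition (a b : ℤ) : R := α.w a (b - a)

/-- The inverse of `α.transition a b` in the ring `D_a D_b`. -/
def transitionInv (a b : ℤ) : R := α.winv a (b - a)

theorem transition_mem (a b : ℤ) : α.transition a b ∈ idealProd (α.D a) (α.D b) := by
  simpa only [transition, add_sub_cancel] using α.w_mem a (b - a)

theorem idem_smul_transition_left (a b : ℤ) :
    α.idem a • α.transition a b = α.transition a b := by
  rw [← α.mem_idealProd_D.1 (α.transition_mem a b), smul_smul, ← mul_assoc,
    (α.isIdempotentElem_idem a).eq]

theorem idem_smul_transition_right (a b : ℤ) :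
    α.idem b • α.transition a b = α.transition a b := by
  rw [← α.mem_idealProd_D.1 (α.transition_mem a b), smul_smul, mul_left_comm,
    (α.isIdempotentElem_idem b).eq]

theorem idem_mul_idem_smul_transitionInv (a b : ℤ) :
    (α.idem a * α.idem b) • α.transitionInv a b = α.transitionInv a b := by
  simpa only [transitionInv, add_sub_cancel] using α.mem_idealProd_D.1 (α.winv_mem a (b - a))

theorem transition_mul_transitionInv (a b : ℤ) :
    α.transition a b * α.transitionInv a b = (α.idem a * α.idem b) • 1 := by
  rw [transition, transitionInv, w_mul_winv, add_sub_cancel, ← center_coe_eq_smul_one]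
  rfl

theorem transitionInv_mul_transition (a b : ℤ) :
    α.transitionInv a b * α.transition a b = (α.idem a * α.idem b) • 1 := by
  rw [transition, transitionInv, winv_mul_w, add_sub_cancel, ← center_coe_eq_smul_one]
  rfl

theorem transition_self (a : ℤ) : α.transition a a = α.idem a • 1 := by
  rw [transition, sub_self, w_zero_right, ← center_coe_eq_smul_one]
  rfl

theorem transition_add_right (i j : ℤ) : α.transition i (i + j) = α.w i j := by
  rw [transition, add_sub_cancel_left]

theorem act_act (i j : ℤ) (a : R) :
    α.act i (α.act j a) =
      α.transition i (i + j) * α.act (i + j) a * α.transitionInv i (i + j) := by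
  set b : R := (α.idem (-j) * α.idem (-j - i)) • a with b_def
  have b_mem : b ∈ idealProd (α.D (-j)) (α.D (-j - i)) := by
    rw [mem_idealProd_D, mul_idem_smul_self]
  have b_mem_j : b ∈ α.D (-j) := by
    rw [mem_D, b_def, mul_smul, idem_smul_idem_smul]
  have b_mem_ij : b ∈ α.D (-(i + j)) := by
    rw [mem_D, b_def, mul_comm, mul_smul, neg_add_rev, ← sub_eq_add_neg, idem_smul_idem_smul]
  have act_j_b : α.act j b = α.idem (-i) • α.act j a := by
    rw [b_def, mul_smul, act_idem_smul, act_idem_smul, add_neg_cancel, idem_zero, one_smul]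
    congr 2; ring
  have act_ij_b : α.act (i + j) b = α.idem i • α.act (i + j) a := by
    rw [b_def, mul_smul, act_idem_smul, act_idem_smul, add_neg_cancel_right,
      show i + j + (-j - i) = 0 by ring, idem_zero, one_smul]
  have act_j_b_mem : (α.α j ⟨b, b_mem_j⟩ : R) ∈ α.D (-i) := by
    rw [act_of_mem, act_j_b, mem_D, idem_smul_idem_smul]
  have key := α.α_comp i j b b_mem b_mem_j b_mem_ij act_j_b_mem
  simp only [act_of_mem, act_j_b, act_ij_b, act_idem_neg_smul] at key
  rw [key, mul_smul_comm, ← smul_mul_assoc, ← transition_add_right, idem_smul_transition_left,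
    transitionInv, add_sub_cancel_left]

theorem act_transition_mul_transition (m a b : ℤ) :
    α.act m (α.transition a b) * α.transition m (m + b) =
      α.transition m (m + a) * α.transition (m + a) (m + b) := by
  set x : R := (α.idem (-m) * α.idem a * α.idem b) • 1 with x_def
  have x_mem : x ∈ idealProd (idealProd (α.D (-m)) (α.D a)) (α.D (a + (b - a))) := by
    rw [add_sub_cancel, mem_idealProd_idealProd_D, smul_smul,
      (((α.isIdempotentElem_idem _).mul (α.isIdempotentElem_idem _)).mul
        (α.isIdempotentElem_idem _)).eq]
  have x_mem_neg : x ∈ α.D (-m) := by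
    rw [mem_D, x_def, mul_assoc, mul_smul, idem_smul_idem_smul]
  have act_x : α.act m x = (α.idem m * α.idem (m + a) * α.idem (m + b)) • 1 := by
    rw [x_def, mul_assoc, mul_smul, act_idem_neg_smul, mul_smul, act_idem_smul, act_idem_smul,
      act_one, mul_rotate, mul_smul, mul_smul]
  have x_mul : x * α.transition a b = α.idem (-m) • α.transition a b := by
    rw [x_def, smul_one_mul, mul_smul, mul_smul, idem_smul_transition_right,
      idem_smul_transition_left]
  calc α.act m (α.transition a b) * α.transition m (m + b)
      = α.act m (x * α.transition a b) * α.transition m (m + b) := by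
        rw [x_mul, act_idem_neg_smul]
    _ = α.act m x * α.transition m (m + a) * α.transition (m + a) (m + b) := by
        simpa only [act_of_mem, transition, add_sub_cancel, add_sub_cancel_left,
          add_sub_add_left_eq_sub] using α.cocycle m a (b - a) x x_mem x_mem_neg
    _ = α.transition m (m + a) * α.transition (m + a) (m + b) := by
        rw [act_x, smul_one_mul, mul_smul, mul_smul, smul_mul_assoc,
          smul_mul_assoc, smul_mul_assoc, ← mul_smul_comm (α.idem (m + b)),
          idem_smul_transition_right, ← mul_smul_comm (α.idem (m + a)),
          idem_smul_transition_left, ← smul_mul_assoc, idem_smul_transition_left]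

/-! ### Extending the twist to units of the ring -/

theorem act_mul_of_act_eq {m : ℤ} {y y' z z' : Subring.center R} (h : α.act m y = (α.idem m * z :))
    (h' : α.act m y' = (α.idem m * z' :)) : α.act m (y * y' :) = (α.idem m * (z * z') :) := by
  rw [Subring.coe_mul, ← smul_eq_mul, ← Subring.smul_def, α.act_smul_of_act_eq h, h',
    Subring.smul_def, smul_eq_mul, ← Subring.coe_mul, mul_left_comm]

theorem act_prod_of_act_eq {κ : Type*} {m : ℤ} {y z : κ → Subring.center R}
    (h : ∀ k, α.act m (y k) = (α.idem m * z k :)) (s : Finset κ) :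
    α.act m (∏ k ∈ s, y k :) = (α.idem m * ∏ k ∈ s, z k :) := by
  classical
  induction s using Finset.induction_on with
  | empty => simpa [center_coe_eq_smul_one] using α.act_one m
  | insert k s hk ih =>
    rw [Finset.prod_insert hk, Finset.prod_insert hk]
    exact α.act_mul_of_act_eq (h k) ih

theorem act_one_sub_idem (m g : ℤ) :
    α.act m (1 - α.idem g :) = (α.idem m * (1 - α.idem (m + g)) :) := by
  rw [AddSubgroupClass.coe_sub, OneMemClass.coe_one, map_sub, act_one, act_idem, mul_one_sub,
    AddSubgroupClass.coe_sub, center_coe_eq_smul_one (α.idem m)]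

theorem prod_one_sub_idem_eq_zero {s : Finset ℤ} {j : ℤ} (hs : ⨆ k ∈ s, α.D (j + k) = ⊤) :
    ∏ k ∈ s, (1 - α.idem (j + k)) = 0 := by
  set z := ∏ k ∈ s, (1 - α.idem (j + k)) with z_def
  have z_idem : IsIdempotentElem z := by
    rw [IsIdempotentElem, z_def, ← Finset.prod_mul_distrib]
    exact Finset.prod_congr rfl fun k _ => (α.isIdempotentElem_idem _).one_sub.eq
  have D_le : ∀ k ∈ s, α.D (j + k) ≤ TwoSidedIdeal.span {((1 - z :) : R)} := by
    intro k hk x hx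
    have idem_mul_z : z * α.idem (j + k) = 0 := by
      rw [z_def, ← Finset.prod_erase_mul _ _ hk, mul_assoc,
        (α.isIdempotentElem_idem _).one_sub_mul_self, mul_zero]
    rw [mem_span_singleton_center_iff_smul_eq z_idem.one_sub, ← α.mem_D.1 hx, smul_smul,
      one_sub_mul, idem_mul_z, sub_zero]
  have one_mem : (1 : R) ∈ TwoSidedIdeal.span {((1 - z :) : R)} :=
    hs.symm.le.trans (iSup₂_le D_le) trivial
  rw [mem_span_singleton_center_iff_smul_eq z_idem.one_sub, ← center_coe_eq_smul_one] at one_mem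
  exact sub_eq_self.1 (Subtype.ext one_mem)

/-- A family, indexed by `g : ℤ`, of decompositions of `1` into orthogonal central idempotents
`part g i`, where `part g i` lies in `D_{g + shift i}`. The family is equivariant under `α`, and the
decomposition for `g` contains the idempotent `1_g` as its piece number `base`. -/
structure EquivariantPartition (ι : Type*) [Fintype ι] where
  shift : ι → ℤ
  base : ι
  part : ℤ → ι → Subring.center R
  complete (g : ℤ) : CompleteOrthogonalIdempotents (part g)
  part_base (g : ℤ) : part g base = α.idem g
  shift_base : shift base = 0
  idem_mul_part (g : ℤ) (i : ι) : α.idem (g + shift i) * part g i = part g i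
  act_part (m g : ℤ) (i : ι) : α.act m (part g i) = (α.idem m * part (m + g) i :)

variable {α}

namespace EquivariantPartition

/-- The partition obtained by making the idempotents `1_{g + shift i}` disjoint, starting from
`1_g = 1_{g + shift ⊥}`. -/
def ofShift {ι : Type*} [Fintype ι] [LinearOrder ι] [OrderBot ι] (shift : ι → ℤ)
    (shift_bot : shift ⊥ = 0) (h : ∀ g, ∏ i, (1 - α.idem (g + shift i)) = 0) :
    α.EquivariantPartition ι where
  shift := shift
  base := ⊥
  part g i := α.idem (g + shift i) * ∏ j with j < i, (1 - α.idem (g + shift j))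
  complete g :=
    completeOrthogonalIdempotents_disjointed (fun _ => α.isIdempotentElem_idem _) (h g)
  part_base g := by simp [shift_bot]
  shift_base := shift_bot
  idem_mul_part g i := by rw [← mul_assoc, (α.isIdempotentElem_idem _).eq]
  act_part m g i := by
    simp only [add_assoc]
    exact α.act_mul_of_act_eq (α.act_idem m _)
      (α.act_prod_of_act_eq (fun _ => α.act_one_sub_idem m _) _)

end EquivariantPartition

theorem IsOfFiniteType.exists_equivariantPartition (hα : α.IsOfFiniteType) :
    ∃ n : ℕ, Nonempty (α.EquivariantPartition (Fin (n + 1))) := by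
  obtain ⟨s, hs⟩ := hα
  refine ⟨s.card, ⟨.ofShift (Fin.cons 0 fun i => (s.equivFin.symm i : ℤ)) rfl fun g => ?_⟩⟩
  rw [Fin.prod_univ_succ]
  refine mul_eq_zero_of_right _ ?_
  simp only [Fin.cons_succ]
  rw [s.equivFin.symm.prod_comp fun k : s => 1 - α.idem (g + k),
    Finset.prod_coe_sort s fun k => 1 - α.idem (g + k)]
  exact α.prod_one_sub_idem_eq_zero (hs g)

variable (α) in
/-- An extension of the twist of `α` to a family of units of `R`: `U a b` restricts to
`w_{a,b-a}` on `D_a D_b`, and `U` satisfies the cocycle identity wherever `α` is defined. -/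
structure IsCocycleExtension (U : ℤ → ℤ → Rˣ) : Prop where
  idem_smul (a b : ℤ) : (α.idem a * α.idem b) • (U a b : R) = α.transition a b
  self (a : ℤ) : U a a = 1
  cocycle (m a b : ℤ) : α.act m (U a b) * U m (m + b) =
    α.idem m • ((U m (m + a) : R) * U (m + a) (m + b))

namespace EquivariantPartition

variable {ι : Type*} [Fintype ι] (P : α.EquivariantPartition ι)

theorem part_mul_part_smul_idem_mul_idem_smul (a b : ℤ) (i j : ι) (x : R) :
    (P.part a i * P.part b j) • (α.idem (a + P.shift i) * α.idem (b + P.shift j)) • x =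
      (P.part a i * P.part b j) • x := by
  rw [smul_smul, mul_comm, mul_mul_mul_comm, P.idem_mul_part, P.idem_mul_part]

/-- `U a b` is glued from the twists of `α` over the products of a piece of the decomposition for
`a` with a piece of the decomposition for `b`. -/
def IsGluing (U : ℤ → ℤ → Rˣ) : Prop :=
  ∀ a b i j, (P.part a i * P.part b j) • (U a b : R) =
    (P.part a i * P.part b j) • α.transition (a + P.shift i) (b + P.shift j)

theorem exists_isGluing : ∃ U, P.IsGluing U := by
  have exists_unit (a b : ℤ) := exists_unit_forall_smul_eq
    (completeOrthogonalIdempotents_prod (P.complete a) (P.complete b))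
    (x := fun i => α.transition (a + P.shift i.1) (b + P.shift i.2))
    (y := fun i => α.transitionInv (a + P.shift i.1) (b + P.shift i.2))
    (fun i => by rw [transition_mul_transitionInv, part_mul_part_smul_idem_mul_idem_smul])
    (fun i => by rw [transitionInv_mul_transition, part_mul_part_smul_idem_mul_idem_smul])
  choose U hU using exists_unit
  exact ⟨U, fun a b i j => hU a b (i, j)⟩

namespace IsGluing

variable {P} {U : ℤ → ℤ → Rˣ} (hU : P.IsGluing U)

include hU

theorem idem_mul_part_smul (a b : ℤ) (j : ι) : (α.idem a * P.part b j) • (U a b : R) =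
    (α.idem a * P.part b j) • α.transition a (b + P.shift j) := by
  simpa only [P.part_base, P.shift_base, add_zero] using hU a b P.base j

theorem part_mul_part_smul_act (m a b : ℤ) (i j : ι) :
    (P.part (m + a) i * P.part (m + b) j) • α.act m (U a b) =
      (P.part (m + a) i * P.part (m + b) j) •
        α.act m (α.transition (a + P.shift i) (b + P.shift j)) := by
  have act_part_mul := α.act_mul_of_act_eq (P.act_part m a i) (P.act_part m b j)
  rw [← α.act_smul_of_act_eq act_part_mul, hU, α.act_smul_of_act_eq act_part_mul]

theorem idem_smul (a b : ℤ) : (α.idem a * α.idem b) • (U a b : R) = α.transition a b := by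
  have h := hU.idem_mul_part_smul a b P.base
  rwa [P.part_base, P.shift_base, add_zero, mul_smul _ _ (α.transition a b),
    idem_smul_transition_right, idem_smul_transition_left] at h

theorem self (a : ℤ) : U a a = 1 := by
  refine Units.ext (eq_of_forall_smul_eq (P.complete a).complete fun i => ?_)
  have h := hU a a i i
  rwa [transition_self, ((P.complete a).idem i).eq, smul_smul, mul_comm, P.idem_mul_part] at h

theorem cocycle (m a b : ℤ) : α.act m (U a b) * U m (m + b) =
    α.idem m • ((U m (m + a) : R) * U (m + a) (m + b)) := by
  refine eq_of_forall_smul_eq (completeOrthogonalIdempotents_prod (P.complete (m + a))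
    (P.complete (m + b))).complete fun ⟨i, j⟩ => ?_
  set p := P.part (m + a) i
  set q := P.part (m + b) j
  calc (p * q) • (α.act m (U a b) * U m (m + b))
      = (α.idem m * (p * q)) • (α.act m (U a b) * U m (m + b)) := by
        rw [mul_comm (α.idem m), mul_smul _ (α.idem m), ← smul_mul_assoc (α.idem m), idem_smul_act]
    _ = (α.idem m * (p * q)) • (α.act m (α.transition (a + P.shift i) (b + P.shift j)) *
          α.transition m (m + b + P.shift j)) :=
        smul_mul_congr
          (smul_eq_smul_of_dvd (dvd_mul_left _ _) (hU.part_mul_part_smul_act m a b i j))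
          (smul_eq_smul_of_dvd (mul_dvd_mul_left _ (dvd_mul_left q p))
            (hU.idem_mul_part_smul m (m + b) j))
    _ = (α.idem m * (p * q)) • (α.transition m (m + a + P.shift i) *
          α.transition (m + a + P.shift i) (m + b + P.shift j)) := by
        rw [add_assoc, add_assoc, act_transition_mul_transition]
    _ = (α.idem m * (p * q)) • ((U m (m + a) : R) * U (m + a) (m + b)) :=
        smul_mul_congr
          (smul_eq_smul_of_dvd (mul_dvd_mul_left _ (dvd_mul_right p q))
            (hU.idem_mul_part_smul m (m + a) i).symm)
          (smul_eq_smul_of_dvd (dvd_mul_left _ _) (hU (m + a) (m + b) i j).symm)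
    _ = (p * q) • α.idem m • ((U m (m + a) : R) * U (m + a) (m + b)) := by
        rw [mul_comm, mul_smul]

theorem isCocycleExtension : α.IsCocycleExtension U :=
  ⟨hU.idem_smul, hU.self, hU.cocycle⟩

end IsGluing

include P in
theorem exists_isCocycleExtension : ∃ U, α.IsCocycleExtension U :=
  P.exists_isGluing.imp fun _ hU => hU.isCocycleExtension

end EquivariantPartition

/-! ### The enveloping action -/

variable (α)

/-- The map `a ↦ (n ↦ α_n(1_{-n} a))`, which embeds `R` into the functions on `ℤ`. -/
def emb : R →ₙ+* (ℤ → R) where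
  toFun a n := α.act n a
  map_mul' _ _ := funext fun _ => map_mul _ _ _
  map_zero' := funext fun _ => map_zero _
  map_add' _ _ := funext fun _ => map_add _ _ _

theorem emb_apply (a : R) (n : ℤ) : α.emb a n = α.act n a := rfl

theorem emb_injective : Function.Injective α.emb := fun a b h => by
  simpa only [emb_apply, act_zero_apply] using congrFun h 0

variable {α}

namespace IsCocycleExtension

variable {U : ℤ → ℤ → Rˣ} (hU : α.IsCocycleExtension U)

include hU

theorem idem_smul_inv (a b : ℤ) :
    (α.idem a * α.idem b) • (↑(U a b)⁻¹ : R) = α.transitionInv a b := by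
  have transitionInv_mul_unit : α.transitionInv a b * U a b = (α.idem a * α.idem b) • 1 := by
    rw [← idem_mul_idem_smul_transitionInv, smul_mul_assoc, ← mul_smul_comm, hU.idem_smul,
      transitionInv_mul_transition]
  rw [← Units.mul_inv_cancel_right (α.transitionInv a b) (U a b), transitionInv_mul_unit,
    smul_one_mul]

/-- The translation action on the functions on `ℤ`, twisted by the extended cocycle. -/
def unitTwistedAction : UnitTwistedAction ℤ (ℤ → R) := .ofTransition U hU.self

theorem unitTwistedAction_β_apply (g : ℤ) (f : ℤ → R) (n : ℤ) :
    hU.unitTwistedAction.β g f n = U n (n + g) * f (n + g) * ↑(U n (n + g))⁻¹ := rfl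

theorem unitTwistedAction_u_apply (g h n : ℤ) : (hU.unitTwistedAction.u g h : ℤ → R) n =
    U n (n + g) * U (n + g) (n + g + h) * ↑(U n (n + (g + h)))⁻¹ := rfl

theorem act_unit (n g h : ℤ) :
    α.act n (U g (g + h)) = α.idem n • (hU.unitTwistedAction.u g h : ℤ → R) n := by
  rw [unitTwistedAction_u_apply, ← smul_mul_assoc, add_assoc n g h, ← hU.cocycle,
    Units.mul_inv_cancel_right]

theorem emb_unit_mul (g h : ℤ) (a : R) :
    α.emb (U g (g + h) * a) = hU.unitTwistedAction.u g h * α.emb a := by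
  funext n
  rw [map_mul, Pi.mul_apply, Pi.mul_apply, emb_apply, emb_apply, hU.act_unit, smul_mul_assoc,
    ← mul_smul_comm, idem_smul_act]

theorem emb_mul_unit (g h : ℤ) (a : R) :
    α.emb (a * U g (g + h)) = α.emb a * hU.unitTwistedAction.u g h := by
  funext n
  rw [map_mul, Pi.mul_apply, Pi.mul_apply, emb_apply, emb_apply, hU.act_unit, mul_smul_comm,
    ← smul_mul_assoc, idem_smul_act]

theorem emb_act_apply (l n : ℤ) (a : R) :
    α.emb (α.act l a) n = α.idem n • hU.unitTwistedAction.β l (α.emb a) n := by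
  rw [unitTwistedAction_β_apply, emb_apply, emb_apply, act_act, ← hU.idem_smul, ← hU.idem_smul_inv,
    smul_mul_assoc, smul_mul_assoc, mul_smul_comm, mul_idem_smul_self, mul_smul,
    ← smul_mul_assoc (α.idem (n + l)), ← mul_smul_comm (α.idem (n + l)), idem_smul_act]

theorem emb_mul_β (l : ℤ) (a b : R) :
    α.emb a * hU.unitTwistedAction.β l (α.emb b) = α.emb (a * α.act l b) := by
  funext n
  rw [map_mul, Pi.mul_apply, Pi.mul_apply, hU.emb_act_apply, mul_smul_comm, ← smul_mul_assoc,
    emb_apply, idem_smul_act]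

theorem β_mul_emb (l : ℤ) (a b : R) :
    hU.unitTwistedAction.β l (α.emb b) * α.emb a = α.emb (α.act l b * a) := by
  funext n
  rw [map_mul, Pi.mul_apply, Pi.mul_apply, hU.emb_act_apply, smul_mul_assoc, ← mul_smul_comm,
    emb_apply, idem_smul_act]

theorem emb_act {l : ℤ} {a : R} (ha : a ∈ α.D (-l)) :
    α.emb (α.act l a) = hU.unitTwistedAction.β l (α.emb a) := by
  funext n
  have idem_smul_act_add : α.idem n • α.act (n + l) a = α.act (n + l) a := by
    rw [← α.mem_D.1 ha, act_idem_smul, add_neg_cancel_right, idem_smul_idem_smul]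
  rw [hU.emb_act_apply, unitTwistedAction_β_apply, emb_apply, ← smul_mul_assoc, ← mul_smul_comm,
    idem_smul_act_add]

theorem mem_D_of_emb_eq_β {i : ℤ} {r s : R}
    (h : α.emb r = hU.unitTwistedAction.β i (α.emb s)) : r ∈ α.D i := by
  rw [mem_D, ← α.act_zero_apply r, ← emb_apply, h, unitTwistedAction_β_apply, emb_apply, zero_add,
    ← smul_mul_assoc, ← mul_smul_comm, idem_smul_act]

theorem isLocalIdeal : hU.unitTwistedAction.IsLocalIdeal (α.emb : R →+ (ℤ → R)).range where
  u_mem g h := by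
    constructor
    · rintro _ ⟨a, rfl⟩
      exact ⟨⟨_, hU.emb_unit_mul g h a⟩, ⟨_, hU.emb_mul_unit g h a⟩⟩
    · rintro _ ⟨a, rfl⟩
      refine ⟨⟨↑(U g (g + h))⁻¹ * a, ?_⟩, ⟨a * ↑(U g (g + h))⁻¹, ?_⟩⟩
      · exact (Units.eq_inv_mul_iff_mul_eq _).2
          ((hU.emb_unit_mul g h _).symm.trans (congrArg α.emb (Units.mul_inv_cancel_left _ a)))
      · exact (Units.eq_mul_inv_iff_mul_eq _).2
          ((hU.emb_mul_unit g h _).symm.trans (congrArg α.emb (Units.inv_mul_cancel_right a _)))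
  mul_mem_left g := by
    rintro _ _ ⟨a, rfl⟩ ⟨b, rfl⟩
    exact ⟨_, (hU.β_mul_emb g a b).symm⟩
  mul_mem_right g := by
    rintro _ _ ⟨a, rfl⟩ ⟨b, rfl⟩
    exact ⟨_, (hU.emb_mul_β g a b).symm⟩

/-- The embedding of `R` into the envelope. -/
def embEnvelope : R →ₙ+* hU.isLocalIdeal.envelope :=
  NonUnitalRingHom.codRestrict α.emb _ fun a => UnitTwistedAction.le_translatesSum _ _ ⟨a, rfl⟩

theorem mul_w_eq_mul_unit {i j : ℤ} {a : R} (ha : a ∈ idealProd (α.D i) (α.D (i + j))) :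
    a * α.w i j = a * U i (i + j) := by
  rw [← transition_add_right, ← hU.idem_smul, mul_smul_comm, ← smul_mul_assoc,
    α.mem_idealProd_D.1 ha]

theorem w_mul_eq_unit_mul {i j : ℤ} {a : R} (ha : a ∈ idealProd (α.D i) (α.D (i + j))) :
    α.w i j * a = U i (i + j) * a := by
  rw [← transition_add_right, ← hU.idem_smul, smul_mul_assoc, ← mul_smul_comm,
    α.mem_idealProd_D.1 ha]

theorem isEnvelopingVia : IsEnvelopingVia α hU.isLocalIdeal.globalAction hU.embEnvelope where
  injective a b h := α.emb_injective (congrArg Subtype.val h)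
  mul_mem_left t r := by
    obtain ⟨a, ha⟩ := hU.isLocalIdeal.mul_mem_of_mem_right t.2 ⟨r, rfl⟩
    exact ⟨a, Subtype.ext ha⟩
  mul_mem_right t r := by
    obtain ⟨a, ha⟩ := hU.isLocalIdeal.mul_mem_of_mem_left ⟨r, rfl⟩ t.2
    exact ⟨a, Subtype.ext ha⟩
  sum_eq_top := by
    have range_eq : Set.range hU.embEnvelope =
        {t : hU.isLocalIdeal.envelope | (t : ℤ → R) ∈ (α.emb : R →+ (ℤ → R)).range} :=
      Set.ext fun _ => exists_congr fun _ => Subtype.ext_iff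
    rw [range_eq, hU.isLocalIdeal.closure_iUnion_image_eq_top]
  map_D i := by
    refine Set.Subset.antisymm ?_ ?_
    · rintro _ ⟨x, hx, rfl⟩
      obtain ⟨y, hy⟩ := (α.α i).surjective ⟨x, hx⟩
      have act_y : α.act i y = x := (α.act_of_mem y.2).symm.trans (congrArg Subtype.val hy)
      refine ⟨⟨x, rfl⟩, hU.embEnvelope y, ⟨y, rfl⟩, Subtype.ext ?_⟩
      exact (hU.emb_act y.2).symm.trans (congrArg α.emb act_y)
    · rintro _ ⟨⟨r, rfl⟩, _, ⟨s, rfl⟩, h⟩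
      exact ⟨r, hU.mem_D_of_emb_eq_β (congrArg Subtype.val h).symm, rfl⟩
  map_α i a := Subtype.ext ((congrArg α.emb (α.act_of_mem a.2)).trans (hU.emb_act a.2))
  map_mul_w i j a ha := Subtype.ext
    ((congrArg α.emb (hU.mul_w_eq_mul_unit ha)).trans (hU.emb_mul_unit i j a))
  map_w_mul i j a ha := Subtype.ext
    ((congrArg α.emb (hU.w_mul_eq_unit_mul ha)).trans (hU.emb_unit_mul i j a))

end IsCocycleExtension

end TwistedPartialAction

theorem mainTheorem4_general {R : Type u} [Ring R] (α : TwistedPartialAction R)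
    (hα : α.IsOfFiniteType) : α.HasEnvelopingAction := by
  obtain ⟨n, ⟨P⟩⟩ := hα.exists_equivariantPartition
  obtain ⟨U, hU⟩ := P.exists_isCocycleExtension
  exact ⟨hU.isLocalIdeal.envelope, inferInstance, hU.isLocalIdeal.globalAction, hU.embEnvelope,
    hU.isEnvelopingVia⟩

theorem mainTheorem4 {R : Type u} [Ring R] (hR : HasFiniteUniformDim R)
    (α : TwistedPartialAction R) (hα : α.IsOfFiniteType) :
    α.HasEnvelopingAction :=
  mainTheorem4_general α hα
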